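/- Let $n>0$ and let $W$ be a standard Brownian motion. For an integrable function $g:[-\frac12,\frac12]\to\mathbb R$, write $P_g$ and $E_g$ for probability and expectation when one observes the white noise model $$dY(t)=g(t)\,dt+n^{-1/2}\,dW(t),\qquad -\tfrac12\le t\le \tfrac12 ,\qquad Y(-\tfrac12)=0 .$$ Let $\mathcal F$ be a nonempty convex set of integrable real functions on $[-\frac12,\frac12]$, let $f\in\mathcal F$ and let $0<\alpha<\frac12$. Denote by $\mathcal I_\alpha(\mathcal F)$ the collection of all measurable interval-valued functions $\mathrm{CI}=\mathrm{CI}(Y)\subseteq\mathbb R$ of the observed path such that $P_g(g(0)\in \mathrm{CI})\ge 1-\alpha$ for every $g\in\mathcal F$, by $L(\mathrm{CI})$ the length of $\mathrm{CI}$, and let $$L^*_\alpha(f,\mathcal F)=\inf_{\mathrm{CI}\in\mathcal I_\alpha(\mathcal F)}E_f\,L(\mathrm{CI})\in[0,\infty]$$ (with $\inf\emptyset=\infty$). For $\varepsilon>0$ let $$\omega(\varepsilon,f,\mathcal F)=\sup\{|g(0)-f(0)| : g\in\mathcal F,\ \|g-f\|_2\le\varepsilon\}\in[0,\infty],$$ where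 $\|\cdot\|_2$ is the $L_2(-\frac12,\frac12)$ norm. Let $\Phi$ and $\phi$ be the standard normal distribution function and density, and $z_\alpha=\Phi^{-1}(1-\alpha)$. Then $$L^*_\alpha(f,\mathcal F)\ \ge\ \Bigl(1-\frac{1}{\sqrt{2\pi}\,z_\alpha}+\frac{\phi(z_\alpha)}{z_\alpha}-\alpha\Bigr)\,\omega\Bigl(\frac{z_\alpha}{\sqrt n},f,\mathcal F\Bigr).$$ In particular, $$L^*_\alpha(f,\mathcal F)\ \ge\ \Bigl(1-\frac{1}{\sqrt{2\pi}\,z_\alpha}\Bigr)\,\omega\Bigl(\frac{z_\alpha}{\sqrt n},f,\mathcal F\Bigr).$$ -/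

import Mathlib

open MeasureTheory ProbabilityTheory
open scoped NNReal ENNReal

noncomputable section

namespace WhiteNoiseCI

/-- The observation interval `[-1/2, 1/2]`. -/
abbrev Interval : Type := Set.Icc (-(1 / 2) : ℝ) (1 / 2)

/-- Lebesgue measure on `[-1/2, 1/2]`. -/
def lebesgue : Measure Interval := Measure.comap Subtype.val (volume : Measure ℝ)

/-- The point `0` of the interval `[-1/2, 1/2]`. -/
def origin : Interval := ⟨0, by norm_num⟩

/-- The path observed in the white noise model `dY(t) = f(t) dt + n^{-1/2} dW(t)` on
`[-1/2, 1/2]`: `Y(t) = ∫_{-1/2}^t f(s) ds + n^{-1/2} W(t)`, where the noise is a standard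
Brownian motion started at time `-1/2`. The Brownian motion `W` is indexed by the time
`t + 1/2 ≥ 0` elapsed since then. -/
def observation {Ω : Type*} (n : ℝ) (W : ℝ≥0 → Ω → ℝ) (f : Interval → ℝ) (ω : Ω) :
    Interval → ℝ :=
  fun t => (∫ s in Set.Iic t, f s ∂lebesgue) + (√n)⁻¹ * W (Real.toNNReal ((t : ℝ) + 1 / 2)) ω

/-- An interval-valued measurable function of the observed path. Paths carry the product
σ-algebra, generated by the coordinates `y ↦ y t`. The interval may be open, closed, half-open,
empty or unbounded. -/
structure IntervalProcedure where
  /-- The interval reported when the path `y` is observed. -/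
  toSet : (Interval → ℝ) → Set ℝ
  ordConnected : ∀ y, (toSet y).OrdConnected
  measurableSet_mem : MeasurableSet {p : (Interval → ℝ) × ℝ | p.2 ∈ toSet p.1}

/-- The interval procedure covers `g(0)` with probability at least `1 - α` under `g`,
for every `g` in the class `F`. -/
def IntervalProcedure.HasCoverage {Ω : Type*} [MeasurableSpace Ω] (C : IntervalProcedure)
    (P : Measure Ω) (W : ℝ≥0 → Ω → ℝ) (n α : ℝ) (F : Set (Interval → ℝ)) : Prop :=
  ∀ g ∈ F, ENNReal.ofReal (1 - α) ≤ P {ω | g origin ∈ C.toSet (observation n W g ω)}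

/-- The expected length of the interval when the drift is `f`. -/
def IntervalProcedure.expectedLength {Ω : Type*} [MeasurableSpace Ω] (C : IntervalProcedure)
    (P : Measure Ω) (W : ℝ≥0 → Ω → ℝ) (n : ℝ) (f : Interval → ℝ) : ℝ≥0∞ :=
  ∫⁻ ω, volume (C.toSet (observation n W f ω)) ∂P

/-- The minimum expected length at `f` of confidence intervals for the value at `0` that have
guaranteed coverage `1 - α` over `F`. -/
def minExpectedLength {Ω : Type*} [MeasurableSpace Ω]
    (P : Measure Ω) (W : ℝ≥0 → Ω → ℝ) (n α : ℝ) (f : Interval → ℝ)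
    (F : Set (Interval → ℝ)) : ℝ≥0∞ :=
  ⨅ (C : IntervalProcedure) (_ : C.HasCoverage P W n α F), C.expectedLength P W n f

/-- The local modulus of continuity
`ω(ε, f, F) = sup {|g(0) - f(0)| : ‖g - f‖₂ ≤ ε, g ∈ F}`, as a number in `[0, ∞]`. -/
def localModulus (ε : ℝ) (f : Interval → ℝ) (F : Set (Interval → ℝ)) : ℝ≥0∞ :=
  ⨆ (g : Interval → ℝ) (_ : g ∈ F) (_ : eLpNorm (g - f) 2 lebesgue ≤ ENNReal.ofReal ε),
    ENNReal.ofReal |g origin - f origin|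

/-- The standard normal distribution function `Φ`. -/
def stdNormalCDF (x : ℝ) : ℝ := cdf (gaussianReal 0 1) x

/-- The standard normal density `φ`. -/
def stdNormalPDF (x : ℝ) : ℝ := gaussianPDFReal 0 1 x

/-- `z_α = Φ⁻¹(1 - α)`, the upper `α`-quantile of the standard normal distribution. -/
def zQuantile (α : ℝ) : ℝ := sInf {x : ℝ | 1 - α ≤ stdNormalCDF x}

end WhiteNoiseCI

end

namespace WhiteNoiseCI

open Filter Topology Set

/-! By Tonelli, the expected length under `f` is the integral over `x` of the probability that the
interval contains `x`. Fix `g` in the modulus class and take the points `x = f(0) + θ (g(0) -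
f(0))`, `0 ≤ θ ≤ 1`. Each is the value at `0` of a drift in `F` by convexity, so it is covered with
probability at least `1 - α = Φ(z)` under that drift. This drift is within `θ z / √n` of `f`, so
Neyman–Pearson leaves probability at least `Φ(z - θ z)` under `f`. Integrating over `θ` gives the
constant times `|g(0) - f(0)|`; then take the supremum over `g`. Mills' inequality `α ≤ φ(z) / z`
gives the simpler constant.

The Neyman–Pearson step (`stdNormalCDF_sub_le_observation`) avoids a change of measure on path
space. On cylinder events the model is a Gaussian vector, where a translation acts only along one
standard normal coordinate independent of the rest (`stdNormalCDF_sub_norm_le_of_hasGaussianLaw`).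
General events are approximated by cylinders. -/

/-! ### Calculus of the standard normal distribution. -/

lemma stdNormalPDF_eq (x : ℝ) : stdNormalPDF x = (√(2 * Real.pi))⁻¹ * Real.exp (-x ^ 2 / 2) := by
  simp [stdNormalPDF, gaussianPDFReal]

lemma stdNormalPDF_pos (x : ℝ) : 0 < stdNormalPDF x :=
  gaussianPDFReal_pos 0 1 x one_ne_zero

lemma hasDerivAt_stdNormalPDF (x : ℝ) : HasDerivAt stdNormalPDF (-x * stdNormalPDF x) x := by
  have h : HasDerivAt (fun y : ℝ => (√(2 * Real.pi))⁻¹ * Real.exp (-y ^ 2 / 2))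
      ((√(2 * Real.pi))⁻¹ * (Real.exp (-x ^ 2 / 2) * (-(2 * x) / 2))) x := by
    have h2 : HasDerivAt (fun y : ℝ => -y ^ 2 / 2) (-(2 * x) / 2) x := by
      simpa using ((hasDerivAt_pow 2 x).neg).div_const 2
    exact h2.exp.const_mul _
  rw [funext stdNormalPDF_eq]
  convert h using 1
  ring

lemma continuous_stdNormalPDF : Continuous stdNormalPDF :=
  continuous_iff_continuousAt.2 fun x => (hasDerivAt_stdNormalPDF x).continuousAt

lemma integrable_stdNormalPDF : Integrable stdNormalPDF := integrable_gaussianPDFReal 0 1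

lemma stdNormalCDF_eq_real (x : ℝ) : stdNormalCDF x = (gaussianReal 0 1).real (Iic x) :=
  cdf_eq_real _ x

lemma stdNormalCDF_nonneg (x : ℝ) : 0 ≤ stdNormalCDF x := cdf_nonneg _ x

lemma stdNormalCDF_eq_integral (x : ℝ) : stdNormalCDF x = ∫ y in Iic x, stdNormalPDF y := by
  rw [stdNormalCDF_eq_real, Measure.real, gaussianReal_apply_eq_integral _ one_ne_zero,
    ENNReal.toReal_ofReal]
  · rfl
  · exact integral_nonneg fun y => gaussianPDFReal_nonneg _ _ _

lemma hasDerivAt_stdNormalCDF (x : ℝ) : HasDerivAt stdNormalCDF (stdNormalPDF x) x := by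
  have h : stdNormalCDF = fun x => stdNormalCDF 0 + ∫ y in (0 : ℝ)..x, stdNormalPDF y := by
    ext x
    rw [stdNormalCDF_eq_integral, stdNormalCDF_eq_integral, ← intervalIntegral.integral_Iic_sub_Iic
      integrable_stdNormalPDF.integrableOn integrable_stdNormalPDF.integrableOn]
    ring
  rw [h]
  exact (intervalIntegral.integral_hasDerivAt_right integrable_stdNormalPDF.intervalIntegrable
    continuous_stdNormalPDF.stronglyMeasurable.stronglyMeasurableAtFilter
    continuous_stdNormalPDF.continuousAt).const_add _

lemma continuous_stdNormalCDF : Continuous stdNormalCDF :=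
  continuous_iff_continuousAt.2 fun x => (hasDerivAt_stdNormalCDF x).continuousAt

lemma strictMono_stdNormalCDF : StrictMono stdNormalCDF :=
  strictMono_of_deriv_pos fun x => by
    rw [(hasDerivAt_stdNormalCDF x).deriv]
    exact stdNormalPDF_pos x

lemma stdNormalCDF_zero : stdNormalCDF 0 = 1 / 2 := by
  have : NullSingletonClass (gaussianReal 0 1) := nullSingletonClass_gaussianReal one_ne_zero
  have h1 : (gaussianReal 0 1).real (Ioi 0) = (gaussianReal 0 1).real (Iic 0) := by
    have h := gaussianReal_map_neg (μ := 0) (v := 1)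
    rw [neg_zero] at h
    conv_rhs => rw [← h]
    rw [map_measureReal_apply measurable_neg measurableSet_Iic]
    have : (fun x : ℝ => -x) ⁻¹' Iic 0 = Ici 0 := by ext x; simp
    rw [this]
    exact measureReal_congr Ioi_ae_eq_Ici
  have h2 := probReal_add_probReal_compl (μ := gaussianReal 0 1) (s := Iic 0) measurableSet_Iic
  rw [compl_Iic, h1] at h2
  rw [stdNormalCDF_eq_real]
  linarith

lemma stdNormalCDF_zQuantile {α : ℝ} (hα0 : 0 < α) (hα : α < 1 / 2) :
    stdNormalCDF (zQuantile α) = 1 - α := by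
  obtain ⟨a, ha⟩ := (tendsto_cdf_atTop (gaussianReal 0 1)).eventually_const_lt
    (show 1 - α < 1 by linarith) |>.exists
  obtain ⟨z, hz⟩ : ∃ z, stdNormalCDF z = 1 - α := by
    have := intermediate_value_univ (0 : ℝ) a continuous_stdNormalCDF
    obtain ⟨z, hz⟩ := this ⟨by rw [stdNormalCDF_zero]; linarith, ha.le⟩
    exact ⟨z, hz⟩
  have h : {x : ℝ | 1 - α ≤ stdNormalCDF x} = Ici z := by
    ext x
    simp [← hz, strictMono_stdNormalCDF.le_iff_le]
  rw [zQuantile, h, csInf_Ici, hz]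

lemma zQuantile_pos {α : ℝ} (hα0 : 0 < α) (hα : α < 1 / 2) : 0 < zQuantile α := by
  rw [← strictMono_stdNormalCDF.lt_iff_lt, stdNormalCDF_zQuantile hα0 hα, stdNormalCDF_zero]
  linarith

lemma tendsto_stdNormalPDF_atTop : Tendsto stdNormalPDF atTop (𝓝 0) := by
  rw [funext stdNormalPDF_eq]
  rw [← mul_zero (√(2 * Real.pi))⁻¹]
  refine (Real.tendsto_exp_atBot.comp ?_).const_mul _
  have : Tendsto (fun x : ℝ => x ^ 2 / 2) atTop atTop :=
    (tendsto_pow_atTop two_ne_zero).atTop_div_const two_pos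
  exact (tendsto_neg_atTop_atBot.comp this).congr fun x => (neg_div _ _).symm

/-- The upper bound of Mills' ratio. -/
lemma mul_one_sub_stdNormalCDF_le {z : ℝ} (hz : 0 < z) :
    z * (1 - stdNormalCDF z) ≤ stdNormalPDF z := by
  -- On the tail `x > z`, `z φ(x) ≤ x φ(x)`, and the latter has antiderivative `-φ`.
  have hd : ∀ x ∈ Ici z, HasDerivAt (fun x => -stdNormalPDF x) (x * stdNormalPDF x) x := by
    intro x _
    exact (hasDerivAt_stdNormalPDF x).neg.congr_deriv (by ring)
  have hpos : ∀ x ∈ Ioi z, 0 ≤ x * stdNormalPDF x := fun x hx =>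
    mul_nonneg (hz.trans hx).le (stdNormalPDF_pos x).le
  have ht : Tendsto (fun x => -stdNormalPDF x) atTop (𝓝 0) := by
    simpa using tendsto_stdNormalPDF_atTop.neg
  have h1 := integral_Ioi_of_hasDerivAt_of_nonneg' hd hpos ht
  have h2 := integrableOn_Ioi_deriv_of_nonneg' hd hpos ht
  have h3 : 1 - stdNormalCDF z = ∫ x in Ioi z, stdNormalPDF x := by
    rw [stdNormalCDF_eq_integral, ← compl_Iic, setIntegral_compl measurableSet_Iic
      integrable_stdNormalPDF]
    congr 1
    exact (integral_gaussianPDFReal_eq_one 0 one_ne_zero).symm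
  rw [h3, ← integral_const_mul]
  calc _ ≤ ∫ x in Ioi z, x * stdNormalPDF x := by
        refine setIntegral_mono_on (integrable_stdNormalPDF.integrableOn.const_mul z) h2
          measurableSet_Ioi fun x hx => ?_
        exact mul_le_mul_of_nonneg_right (le_of_lt hx) (stdNormalPDF_pos x).le
    _ = stdNormalPDF z := by rw [h1]; ring

/-- Since `φ' = -x φ`, an antiderivative of `Φ` is `x Φ(x) + φ(x)`. The endpoint `θ = 1` contributes
`φ(0) / z`, the negative term of the constant. -/
lemma integral_stdNormalCDF {z : ℝ} (hz : 0 < z) :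
    ∫ θ in (0 : ℝ)..1, stdNormalCDF (z - θ * z)
      = stdNormalCDF z + stdNormalPDF z / z - 1 / (√(2 * Real.pi) * z) := by
  have hΨ : ∀ x, HasDerivAt (fun x => x * stdNormalCDF x + stdNormalPDF x) (stdNormalCDF x) x := by
    intro x
    refine (((hasDerivAt_id x).mul (hasDerivAt_stdNormalCDF x)).add
      (hasDerivAt_stdNormalPDF x)).congr_deriv ?_
    simp
  have h : ∀ θ ∈ uIcc (0 : ℝ) 1, HasDerivAt (fun θ => -((z - θ * z) * stdNormalCDF (z - θ * z)
      + stdNormalPDF (z - θ * z)) / z) (stdNormalCDF (z - θ * z)) θ := by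
    intro θ _
    have h1 : HasDerivAt (fun θ : ℝ => z - θ * z) (-z) θ := by
      simpa using ((hasDerivAt_id θ).mul_const z).const_sub z
    refine ((((hΨ (z - θ * z)).comp θ h1).neg).div_const z).congr_deriv ?_
    field_simp
  rw [intervalIntegral.integral_eq_sub_of_hasDerivAt h]
  · have : stdNormalPDF 0 = 1 / √(2 * Real.pi) := by simp [stdNormalPDF_eq]
    simp only [one_mul, sub_self, zero_mul, sub_zero, zero_add, this]
    field_simp
    ring
  · exact (continuous_stdNormalCDF.comp (by fun_prop)).intervalIntegrable _ _

/-! ### Neyman–Pearson for a Gaussian shift. -/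

lemma stdNormalPDF_sub (σ x : ℝ) :
    stdNormalPDF (x - σ) = Real.exp (σ * x - σ ^ 2 / 2) * stdNormalPDF x := by
  rw [stdNormalPDF_eq, stdNormalPDF_eq, mul_left_comm, ← Real.exp_add]
  congr 2
  ring

lemma gaussianReal_real_eq_integral {s : Set ℝ} (hs : MeasurableSet s) (σ : ℝ) :
    (gaussianReal 0 1).real ((fun u => u + σ) ⁻¹' s)
      = ∫ x, s.indicator (fun x => stdNormalPDF (x - σ)) x := by
  rw [← map_measureReal_apply (by fun_prop) hs, gaussianReal_map_add_const, zero_add,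
    integral_indicator hs, Measure.real, gaussianReal_apply_eq_integral _ one_ne_zero,
    ENNReal.toReal_ofReal]
  · simp_rw [stdNormalPDF, gaussianPDFReal_sub, zero_add]
  · exact integral_nonneg fun y => gaussianPDFReal_nonneg _ _ _

/-- The Neyman–Pearson inequality for the Gaussian shift family, in Lagrangian form. -/
lemma gaussian_shift_lagrangian {s : Set ℝ} (hs : MeasurableSet s) {σ : ℝ} (hσ : 0 ≤ σ) (z : ℝ) :
    stdNormalCDF (z - σ) - Real.exp (σ * z - σ ^ 2 / 2) * stdNormalCDF z
      ≤ (gaussianReal 0 1).real ((fun u => u + σ) ⁻¹' s)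
        - Real.exp (σ * z - σ ^ 2 / 2) * (gaussianReal 0 1).real s := by
  set k := Real.exp (σ * z - σ ^ 2 / 2) with hk
  have h1 : stdNormalCDF (z - σ) = (gaussianReal 0 1).real ((fun u => u + σ) ⁻¹' Iic z) := by
    rw [stdNormalCDF_eq_real]
    congr 1
    ext u
    simp [le_sub_iff_add_le]
  have h2 : ∀ {t : Set ℝ}, MeasurableSet t →
      (gaussianReal 0 1).real t = ∫ x, t.indicator stdNormalPDF x := by
    intro t ht
    simpa using gaussianReal_real_eq_integral ht 0
  have i1 : ∀ {t : Set ℝ}, MeasurableSet t → Integrable (t.indicator stdNormalPDF) :=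
    fun ht => integrable_stdNormalPDF.indicator ht
  have i2 : ∀ {t : Set ℝ}, MeasurableSet t →
      Integrable (t.indicator fun x => stdNormalPDF (x - σ)) :=
    fun ht => (integrable_stdNormalPDF.comp_sub_right σ).indicator ht
  rw [h1, stdNormalCDF_eq_real, gaussianReal_real_eq_integral measurableSet_Iic,
    gaussianReal_real_eq_integral hs, h2 hs, h2 measurableSet_Iic, ← integral_const_mul,
    ← integral_const_mul, ← integral_sub (i2 hs) ((i1 hs).const_mul k),
    ← integral_sub (i2 measurableSet_Iic) ((i1 measurableSet_Iic).const_mul k)]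
  refine integral_mono ((i2 measurableSet_Iic).sub ((i1 measurableSet_Iic).const_mul k))
    ((i2 hs).sub ((i1 hs).const_mul k)) fun x => ?_
  -- The likelihood ratio `exp (σ x - σ ^ 2 / 2)` is nondecreasing and equals `k` at `z`, so the
  -- integrand is pointwise smallest when the set is `Iic z`.
  have hx := stdNormalPDF_pos x
  by_cases hxz : x ≤ z
  · have : Real.exp (σ * x - σ ^ 2 / 2) ≤ k := Real.exp_le_exp.2 (by nlinarith)
    have h3 : stdNormalPDF (x - σ) ≤ k * stdNormalPDF x := by
      rw [stdNormalPDF_sub]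
      exact mul_le_mul_of_nonneg_right this hx.le
    by_cases hxs : x ∈ s <;> simp [hxz, hxs, h3]
  · have : k ≤ Real.exp (σ * x - σ ^ 2 / 2) := Real.exp_le_exp.2 (by nlinarith)
    have h3 : k * stdNormalPDF x ≤ stdNormalPDF (x - σ) := by
      rw [stdNormalPDF_sub]
      exact mul_le_mul_of_nonneg_right this hx.le
    by_cases hxs : x ∈ s <;> simp [hxz, hxs, h3]

/-- The Neyman–Pearson bound for shifting a standard normal variable in the presence of an
independent nuisance variable. -/
theorem stdNormalCDF_sub_le_of_indepFun {Ω E : Type*} [MeasurableSpace Ω] [MeasurableSpace E]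
    {P : Measure Ω} [IsProbabilityMeasure P] {Z : Ω → E} {U : Ω → ℝ} (hZ : AEMeasurable Z P)
    (hU : HasLaw U (gaussianReal 0 1) P) (hZU : IndepFun Z U P) {D : Set (E × ℝ)}
    (hD : MeasurableSet D) {σ z : ℝ} (hσ : 0 ≤ σ)
    (h : stdNormalCDF z ≤ P.real {ω | (Z ω, U ω) ∈ D}) :
    stdNormalCDF (z - σ) ≤ P.real {ω | (Z ω, U ω + σ) ∈ D} := by
  have : IsProbabilityMeasure (P.map Z) := Measure.isProbabilityMeasure_map hZ
  have hprod : P.map (fun ω => (Z ω, U ω)) = (P.map Z).prod (gaussianReal 0 1) := by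
    rw [(indepFun_iff_map_prod_eq_prod_map_map hZ hU.aemeasurable).1 hZU, hU.map_eq]
  have key : ∀ {D : Set (E × ℝ)}, MeasurableSet D → P.real {ω | (Z ω, U ω) ∈ D}
      = ∫ ζ, (gaussianReal 0 1).real (Prod.mk ζ ⁻¹' D) ∂(P.map Z) := by
    intro D hD
    have : P.real {ω | (Z ω, U ω) ∈ D} = (P.map (fun ω => (Z ω, U ω))).real D := by
      rw [map_measureReal_apply_of_aemeasurable (hZ.prodMk hU.aemeasurable) hD]
      rfl
    rw [this, hprod, measureReal_def, Measure.prod_apply hD, ← integral_toReal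
      (measurable_measure_prodMk_left hD).aemeasurable (Eventually.of_forall fun _ => by finiteness)]
    rfl
  have hD' : MeasurableSet ((fun p : E × ℝ => (p.1, p.2 + σ)) ⁻¹' D) :=
    (by fun_prop : Measurable fun p : E × ℝ => (p.1, p.2 + σ)) hD
  have hint : ∀ {D : Set (E × ℝ)}, MeasurableSet D →
      Integrable (fun ζ => (gaussianReal 0 1).real (Prod.mk ζ ⁻¹' D)) (P.map Z) := by
    intro D hD
    refine Integrable.of_bound (measurable_measure_prodMk_left hD).ennreal_toReal.aestronglyMeasurable
      1 (Eventually.of_forall fun ζ => ?_)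
    rw [Real.norm_of_nonneg measureReal_nonneg]
    exact measureReal_le_one
  have hint' : Integrable (fun ζ =>
      (gaussianReal 0 1).real ((fun u => u + σ) ⁻¹' (Prod.mk ζ ⁻¹' D))) (P.map Z) := hint hD'
  have h2 : P.real {ω | (Z ω, U ω + σ) ∈ D}
      = ∫ ζ, (gaussianReal 0 1).real ((fun u => u + σ) ⁻¹' (Prod.mk ζ ⁻¹' D)) ∂(P.map Z) :=
    key hD'
  rw [key hD] at h
  -- The sections of `D` need not individually have probability at least `Φ(z)`. The Lagrangian form
  -- needs no such constraint, so it can be averaged over the nuisance variable.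
  have h3 : stdNormalCDF (z - σ) - Real.exp (σ * z - σ ^ 2 / 2) * stdNormalCDF z
      ≤ ∫ ζ, ((gaussianReal 0 1).real ((fun u => u + σ) ⁻¹' (Prod.mk ζ ⁻¹' D))
        - Real.exp (σ * z - σ ^ 2 / 2) * (gaussianReal 0 1).real (Prod.mk ζ ⁻¹' D)) ∂(P.map Z) := by
    have hi := hint'.sub ((hint hD).const_mul (Real.exp (σ * z - σ ^ 2 / 2)))
    have := integral_mono (integrable_const _) hi fun ζ =>
      gaussian_shift_lagrangian (measurable_prodMk_left hD : MeasurableSet (Prod.mk ζ ⁻¹' D)) hσ z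
    simpa using! this
  rw [integral_sub hint' ((hint hD).const_mul _), integral_const_mul] at h3
  rw [h2]
  nlinarith [mul_le_mul_of_nonneg_left h (Real.exp_pos (σ * z - σ ^ 2 / 2)).le]

/-! ### Measurability of the observed path, and Lebesgue measure on the interval. -/

/-- A process with almost surely continuous paths is almost everywhere measurable as a random
path. -/
lemma aemeasurable_path_of_continuous {Ω T : Type*} [MeasurableSpace Ω] {P : Measure Ω}
    [TopologicalSpace T] [FirstCountableTopology T] [TopologicalSpace.SeparableSpace T]
    {X : T → Ω → ℝ} (hX : ∀ t, AEMeasurable (X t) P) (hc : ∀ᵐ ω ∂P, Continuous (X · ω)) :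
    AEMeasurable (fun ω t => X t ω) P := by
  classical
  obtain ⟨Q, hQc, hQd⟩ := TopologicalSpace.exists_countable_dense T
  have hgood : ∀ᵐ ω ∂P, Continuous (X · ω) ∧ ∀ q ∈ Q, X q ω = (hX q).mk _ ω := by
    filter_upwards [hc, (ae_ball_iff hQc).2 fun q _ => (hX q).ae_eq_mk] with ω h1 h2
    exact ⟨h1, h2⟩
  obtain ⟨N, hN, hNm, hNP⟩ := exists_measurable_superset_of_null (ae_iff.1 hgood)
  have hE : ∀ ω ∉ N, Continuous (X · ω) ∧ ∀ q ∈ Q, X q ω = (hX q).mk _ ω := by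
    intro ω hω
    by_contra h
    exact hω (hN h)
  -- Off `N` the path is continuous and agrees with measurable versions on `Q`; setting it to zero
  -- on `N` makes every coordinate a pointwise limit of measurable functions.
  let X' : T → Ω → ℝ := fun t ω => if ω ∈ N then 0 else X t ω
  have hQm : ∀ q ∈ Q, Measurable (X' q) := by
    intro q hq
    have : X' q = fun ω => if ω ∈ N then 0 else (hX q).mk _ ω := by
      ext ω
      by_cases hω : ω ∈ N
      · simp [X', hω]
      · simp [X', hω, (hE ω hω).2 q hq]
    rw [this]
    exact Measurable.ite hNm measurable_const (hX q).measurable_mk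
  have hXm : ∀ t, Measurable (X' t) := by
    intro t
    obtain ⟨u, huQ, hut⟩ := mem_closure_iff_seq_limit.1 (hQd t)
    refine measurable_of_tendsto_metrizable (fun k => hQm (u k) (huQ k))
      (tendsto_pi_nhds.2 fun ω => ?_)
    by_cases hω : ω ∈ N
    · simp [X', hω]
    · simpa [X', hω] using! ((hE ω hω).1.tendsto t).comp hut
  refine ⟨fun ω t => X' t ω, measurable_pi_lambda _ hXm, ?_⟩
  filter_upwards [measure_eq_zero_iff_ae_notMem.1 hNP] with ω hω
  ext t
  simp [X', hω]

lemma aemeasurable_observation {Ω : Type*} [MeasurableSpace Ω] {P : Measure Ω}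
    {W : ℝ≥0 → Ω → ℝ} (hW : IsBrownianReal W P) (n : ℝ) (f : Interval → ℝ) :
    AEMeasurable (observation n W f) P := by
  have hm : Measurable fun (w : ℝ≥0 → ℝ) (t : Interval) =>
      (∫ s in Set.Iic t, f s ∂lebesgue) + (√n)⁻¹ * w (Real.toNNReal ((t : ℝ) + 1 / 2)) := by
    fun_prop
  exact hm.comp_aemeasurable (aemeasurable_path_of_continuous hW.aemeasurable hW.cont)

lemma lebesgue_Iic (t : Interval) : lebesgue (Iic t) = ENNReal.ofReal (t + 1 / 2) := by
  rw [lebesgue, comap_subtype_coe_apply measurableSet_Icc]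
  have : (Subtype.val '' Iic t : Set ℝ) = Icc (-(1 / 2) : ℝ) (t : ℝ) := by
    ext x
    constructor
    · rintro ⟨y, hy, rfl⟩
      exact ⟨y.2.1, hy⟩
    · rintro ⟨h1, h2⟩
      exact ⟨⟨x, h1, h2.trans t.2.2⟩, h2, rfl⟩
  rw [this, Real.volume_Icc]
  congr 1
  ring

lemma lebesgue_real_Iic (t : Interval) : lebesgue.real (Iic t) = t + 1 / 2 := by
  rw [measureReal_def, lebesgue_Iic, ENNReal.toReal_ofReal]
  linarith [t.2.1]

instance : IsFiniteMeasure lebesgue := by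
  refine ⟨?_⟩
  rw [lebesgue, comap_subtype_coe_apply measurableSet_Icc, image_univ, Subtype.range_coe,
    Real.volume_Icc]
  exact ENNReal.ofReal_lt_top

/-! ### Translations of Gaussian vectors. -/

/-- If the covariance of a centered Gaussian vector is represented by vectors `e i` of an inner
product space, then translating by `⟪e i, h⟫` is at most as detectable as shifting a standard
normal variable by `‖h‖`. -/
theorem stdNormalCDF_sub_norm_le_of_hasGaussianLaw {Ω ι H : Type*} [MeasurableSpace Ω]
    {P : Measure Ω} [IsProbabilityMeasure P] [Fintype ι] [NormedAddCommGroup H]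
    [InnerProductSpace ℝ H] {X : ι → Ω → ℝ} (hX : HasGaussianLaw (fun ω i => X i ω) P)
    (h0 : ∀ i, P[X i] = 0) {e : ι → H} (hcov : ∀ i j, cov[X i, X j; P] = inner ℝ (e i) (e j))
    (h : H) {B : Set (ι → ℝ)} (hB : MeasurableSet B) {z : ℝ}
    (hz : stdNormalCDF z ≤ P.real {ω | (fun i => X i ω) ∈ B}) :
    stdNormalCDF (z - ‖h‖) ≤ P.real {ω | (fun i => X i ω + inner ℝ (e i) h) ∈ B} := by
  -- Only the projection `p` of `h` onto the span of the `e i` is visible through the inner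
  -- products, and its norm is no larger.
  let K : Submodule ℝ H := Submodule.span ℝ (range e)
  have : FiniteDimensional ℝ K := FiniteDimensional.span_of_finite ℝ (finite_range e)
  set p : H := K.starProjection h with hp
  have hpe : ∀ i, inner ℝ (e i) h = inner ℝ (e i) p := by
    intro i
    have := K.starProjection_inner_eq_zero h (e i) (Submodule.subset_span (mem_range_self i))
    rw [real_inner_comm, inner_sub_right] at this
    linarith
  refine (strictMono_stdNormalCDF.monotone
    (sub_le_sub_left (K.norm_starProjection_apply_le h) z)).trans ?_
  simp_rw [hpe, ← hp]
  obtain ⟨c, hc⟩ := (Submodule.mem_span_range_iff_exists_fun ℝ).1 (K.starProjection_apply_mem h)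
  rw [← hp] at hc
  by_cases hp0 : p = 0
  · simpa [hp0] using hz
  have hpn : ‖p‖ ≠ 0 := norm_ne_zero_iff.2 hp0
  have hXL : ∀ i, MemLp (X i) 2 P := fun i => (hX.eval i).memLp_two
  -- `U` is the Gaussian variable representing the unit vector `p / ‖p‖`, with `X i` representing `e
  -- i`.
  set U : Ω → ℝ := fun ω => ∑ i, (‖p‖⁻¹ * c i) * X i ω with hU
  have hUL : MemLp U 2 P := by
    have := memLp_finsetSum' (μ := P) (p := 2) Finset.univ
      (f := fun i ω => (‖p‖⁻¹ * c i) * X i ω) fun i _ => (hXL i).const_mul _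
    convert this using 1
    ext ω
    simp [hU]
  have hcovU : ∀ i, cov[X i, U; P] = inner ℝ (e i) p / ‖p‖ := by
    intro i
    rw [hU, covariance_fun_sum_right (fun j => (hXL j).const_mul _) (hXL i)]
    simp_rw [covariance_const_mul_right, hcov]
    rw [← hc, inner_sum, Finset.sum_div]
    refine Finset.sum_congr rfl fun j _ => ?_
    rw [inner_smul_right, hc]
    ring
  have hvarU : cov[U, U; P] = 1 := by
    conv_lhs => arg 1; rw [hU]
    rw [covariance_fun_sum_left (fun j => (hXL j).const_mul _) hUL]
    simp_rw [covariance_const_mul_left, hcovU]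
    have : ∑ i, c i * inner ℝ (e i) p = ‖p‖ ^ 2 := by
      have := sum_inner (𝕜 := ℝ) Finset.univ (fun i => c i • e i) p
      simp_rw [hc, real_inner_smul_left] at this
      rw [← this, real_inner_self_eq_norm_sq]
    calc _ = (∑ i, c i * inner ℝ (e i) p) / ‖p‖ ^ 2 := by
          rw [Finset.sum_div]
          refine Finset.sum_congr rfl fun i _ => ?_
          field_simp
      _ = 1 := by rw [this, div_self (pow_ne_zero 2 hpn)]
  -- `η i` is the regression coefficient of `X i` on `U`, so the residual `Z` is uncorrelated with
  -- `U`, hence independent by joint Gaussianity.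
  let η : ι → ℝ := fun i => inner ℝ (e i) p / ‖p‖
  let Z : ι → Ω → ℝ := fun i ω => X i ω - η i * U ω
  have hZU : HasGaussianLaw (fun ω => (fun i => Z i ω, fun _ : Unit => U ω)) P := by
    let l : (ι → ℝ) →ₗ[ℝ] ℝ := ∑ i, (‖p‖⁻¹ * c i) • LinearMap.proj i
    let L : (ι → ℝ) →ₗ[ℝ] (ι → ℝ) × (Unit → ℝ) :=
      (LinearMap.pi fun i => LinearMap.proj i - η i • l).prod (LinearMap.pi fun _ => l)
    refine (hX.map_fun (LinearMap.toContinuousLinearMap L)).congr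
      (Eventually.of_forall fun ω => ?_)
    ext i <;> simp [L, l, Z, hU, LinearMap.pi_apply]
  have hUG : HasGaussianLaw U P := hZU.snd.eval ()
  have hUlaw : HasLaw U (gaussianReal 0 1) P := by
    refine ⟨hUL.aemeasurable, ?_⟩
    have hU0 : P[U] = 0 := by
      rw [hU, integral_finsetSum _ fun i _ => ((hXL i).integrable (by norm_num)).const_mul _]
      simp_rw [integral_const_mul, h0]
      simp
    rw [hUG.map_eq_gaussianReal, hU0, ← covariance_self hUL.aemeasurable, hvarU]
    simp
  have hind : IndepFun (fun ω i => Z i ω) U P := by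
    refine (HasGaussianLaw.indepFun_of_covariance_eval (Y := fun _ : Unit => U) hZU
      fun i _ => ?_).comp measurable_id (measurable_pi_apply ())
    rw [covariance_fun_sub_left (hXL i) (hUL.const_mul _) hUL, covariance_const_mul_left, hcovU,
      hvarU]
    simp [η]
  let G : (ι → ℝ) × ℝ → ι → ℝ := fun q i => q.1 i + η i * q.2
  have hG : Measurable G := by fun_prop
  have key := stdNormalCDF_sub_le_of_indepFun hZU.fst.aemeasurable hUlaw hind (hG hB)
    (norm_nonneg p) (z := z) (by simpa [G, Z] using hz)
  refine key.trans_eq ?_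
  congr 1
  ext ω
  -- Since `η i * ‖p‖` is the inner product of `e i` and `p`, the translation moves `U` by `‖p‖` and
  -- fixes `Z`.
  have : G (fun i => Z i ω, U ω + ‖p‖) = fun i => X i ω + inner ℝ (e i) p := by
    ext i
    simp only [G, Z, η]
    field_simp
    ring
  simp only [mem_ofPred_eq, mem_preimage, this]

/-- Identifies the Brownian covariance with the Gram matrix of indicators of initial segments;
integrated drifts are inner products with the same vectors. -/
lemma inner_indicatorConstLp_Iic (s t : Interval) :
    inner ℝ (indicatorConstLp 2 (measurableSet_Iic (a := s)) (measure_ne_top lebesgue _) (1 : ℝ))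
        (indicatorConstLp 2 (measurableSet_Iic (a := t)) (measure_ne_top lebesgue _) (1 : ℝ))
      = ((min (Real.toNNReal ((s : ℝ) + 1 / 2)) (Real.toNNReal ((t : ℝ) + 1 / 2)) : ℝ≥0) : ℝ) := by
  rw [L2.real_inner_indicatorConstLp_one_indicatorConstLp_one, Iic_inter_Iic, lebesgue_real_Iic,
    NNReal.coe_min, Real.coe_toNNReal _ (by linarith [s.2.1]),
    Real.coe_toNNReal _ (by linarith [t.2.1]), min_add_add_right]
  congr 1

/-! ### Neyman–Pearson in the white noise model. -/

section

variable {Ω : Type*} [MeasurableSpace Ω] {P : Measure Ω} [IsProbabilityMeasure P]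
  {W : ℝ≥0 → Ω → ℝ} {n : ℝ} {f g : Interval → ℝ} {ε : ℝ}

lemma stdNormalCDF_sub_le_cylinder (hW : IsBrownianReal W P) (hn : 0 < n)
    (hf : Integrable f lebesgue) (hg : Integrable g lebesgue) (hε : 0 ≤ ε)
    (hfg : eLpNorm (f - g) 2 lebesgue ≤ ENNReal.ofReal ε) (I : Finset Interval)
    {S : Set (I → ℝ)} (hS : MeasurableSet S) {z : ℝ}
    (hz : stdNormalCDF z ≤ P.real {ω | observation n W g ω ∈ cylinder I S}) :
    stdNormalCDF (z - √n * ε) ≤ P.real {ω | observation n W f ω ∈ cylinder I S} := by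
  have hn' : √n ≠ 0 := (Real.sqrt_pos.2 hn).ne'
  have hL : MemLp (f - g) 2 lebesgue :=
    ⟨(hf.sub hg).aestronglyMeasurable, hfg.trans_lt ENNReal.ofReal_lt_top⟩
  let τ : I → ℝ≥0 := fun i => Real.toNNReal ((i : ℝ) + 1 / 2)
  let e : I → Lp ℝ 2 lebesgue := fun i =>
    indicatorConstLp 2 (measurableSet_Iic (a := i.1)) (measure_ne_top lebesgue _) (1 : ℝ)
  -- The factor `√n` expresses the drift difference in units of the noise.
  let h : Lp ℝ 2 lebesgue := √n • hL.toLp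
  have hnorm : ‖h‖ ≤ √n * ε := by
    rw [norm_smul, Real.norm_of_nonneg (Real.sqrt_nonneg n), Lp.norm_toLp]
    gcongr
    exact ENNReal.toReal_le_of_le_ofReal hε hfg
  have hinner : ∀ i, inner ℝ (e i) h
      = √n * ((∫ s in Iic i.1, f s ∂lebesgue) - ∫ s in Iic i.1, g s ∂lebesgue) := by
    intro i
    rw [inner_smul_right, L2.inner_indicatorConstLp_one,
      ← integral_sub hf.integrableOn hg.integrableOn]
    congr 1
    refine setIntegral_congr_ae measurableSet_Iic ?_
    filter_upwards [hL.coeFn_toLp] with s hs _ using hs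
  have hX : HasGaussianLaw (fun ω i => W (τ i) ω) P := by
    have := (hW.isGaussianProcess.comp_right
      fun t : Interval => Real.toNNReal ((t : ℝ) + 1 / 2)).hasGaussianLaw I
    exact this
  let B : Set (I → ℝ) :=
    (fun x i => (∫ s in Iic i.1, g s ∂lebesgue) + (√n)⁻¹ * x i) ⁻¹' S
  have hB : MeasurableSet B :=
    (by fun_prop : Measurable fun (x : I → ℝ) (i : I) =>
      (∫ s in Iic i.1, g s ∂lebesgue) + (√n)⁻¹ * x i) hS
  have key := stdNormalCDF_sub_norm_le_of_hasGaussianLaw (X := fun i => W (τ i)) hX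
    (fun i => hW.integral_eval _) (e := e)
    (fun i j => by rw [hW.covariance_eval]; exact (inner_indicatorConstLp_Iic _ _).symm) h hB hz
  refine (strictMono_stdNormalCDF.monotone (sub_le_sub_left hnorm z)).trans (key.trans_eq ?_)
  congr 1
  ext ω
  have : (fun i : I => (∫ s in Iic i.1, g s ∂lebesgue)
      + (√n)⁻¹ * (W (τ i) ω + inner ℝ (e i) h)) = I.restrict (observation n W f ω) := by
    ext i
    rw [hinner]
    simp only [observation, Finset.restrict, τ]
    field_simp
    ring
  simp only [mem_ofPred_eq, B, mem_preimage, this, mem_cylinder]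

/-- Neyman–Pearson bound for the white noise model: an event whose probability under the drift `g`
is at least `Φ z` has probability at least `Φ (z - √n ε)` under any drift `f` with
`‖f - g‖₂ ≤ ε`. -/
theorem stdNormalCDF_sub_le_observation (hW : IsBrownianReal W P) (hn : 0 < n)
    (hf : Integrable f lebesgue) (hg : Integrable g lebesgue) (hε : 0 ≤ ε)
    (hfg : eLpNorm (f - g) 2 lebesgue ≤ ENNReal.ofReal ε) {A : Set (Interval → ℝ)}
    (hA : MeasurableSet A) {z : ℝ}
    (hz : stdNormalCDF z ≤ P.real {ω | observation n W g ω ∈ A}) :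
    stdNormalCDF (z - √n * ε) ≤ P.real {ω | observation n W f ω ∈ A} := by
  have mf := aemeasurable_observation hW n f
  have mg := aemeasurable_observation hW n g
  have hPf : IsProbabilityMeasure (P.map (observation n W f)) := Measure.isProbabilityMeasure_map mf
  have hPg : IsProbabilityMeasure (P.map (observation n W g)) := Measure.isProbabilityMeasure_map mg
  have ef : ∀ {B : Set (Interval → ℝ)}, MeasurableSet B →
      P.real {ω | observation n W f ω ∈ B} = (P.map (observation n W f)).real B :=
    fun hB => (map_measureReal_apply_of_aemeasurable mf hB).symm
  have eg : ∀ {B : Set (Interval → ℝ)}, MeasurableSet B →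
      P.real {ω | observation n W g ω ∈ B} = (P.map (observation n W g)).real B :=
    fun hB => (map_measureReal_apply_of_aemeasurable mg hB).symm
  have happrox : ∀ δ > 0, ∀ z', stdNormalCDF z' ≤ stdNormalCDF z - δ →
      stdNormalCDF (z' - √n * ε) - δ ≤ P.real {ω | observation n W f ω ∈ A} := by
    intro δ hδ z' hz'
    -- Approximating in the sum of the two laws makes one cylinder serve both drifts.
    obtain ⟨B, hB, hBA⟩ := exists_measure_symmDiff_lt_of_generateFrom_isSetRing
      (μ := P.map (observation n W f) + P.map (observation n W g))
      (isSetRing_measurableCylinders (α := fun _ : Interval => ℝ))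
      ⟨{univ}, countable_singleton _, by simpa using univ_mem_measurableCylinders fun _ : Interval => ℝ, by simp⟩
      generateFrom_measurableCylinders.symm hA (ENNReal.ofReal_pos.2 hδ)
    have hBm : MeasurableSet B := MeasurableSet.of_mem_measurableCylinders hB
    have hsd : ∀ (μ : Measure (Interval → ℝ)) [IsProbabilityMeasure μ],
        μ (symmDiff B A) ≤ ENNReal.ofReal δ → |μ.real B - μ.real A| ≤ δ := by
      intro μ _ hμ
      refine (abs_measureReal_sub_le_measureReal_symmDiff hBm.nullMeasurableSet
        hA.nullMeasurableSet).trans ?_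
      exact ENNReal.toReal_le_of_le_ofReal hδ.le hμ
    have h1 := hsd (P.map (observation n W f))
      ((Measure.le_iff'.1 (Measure.le_add_right le_rfl) _).trans hBA.le)
    have h2 := hsd (P.map (observation n W g))
      ((Measure.le_iff'.1 (Measure.le_add_left le_rfl) _).trans hBA.le)
    rw [abs_le] at h1 h2
    obtain ⟨I, S, hS, rfl⟩ := (mem_measurableCylinders _).1 hB
    rw [eg hA] at hz
    have h3 := stdNormalCDF_sub_le_cylinder hW hn hf hg hε hfg I hS (z := z')
      (by rw [eg hBm]; linarith)
    rw [ef hBm] at h3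
    rw [ef hA]
    linarith
  -- The approximation error is taken to be `Φ(z) - Φ(z')`, which vanishes as `z'` increases to `z`.
  have hcont : Tendsto (fun z' => stdNormalCDF (z' - √n * ε) - (stdNormalCDF z - stdNormalCDF z'))
      (𝓝[<] z) (𝓝 (stdNormalCDF (z - √n * ε))) := by
    have : Continuous fun z' =>
        stdNormalCDF (z' - √n * ε) - (stdNormalCDF z - stdNormalCDF z') := by
      have := continuous_stdNormalCDF
      fun_prop
    simpa using (this.tendsto z).mono_left nhdsWithin_le_nhds
  refine le_of_tendsto hcont ?_
  filter_upwards [self_mem_nhdsWithin] with z' (hz' : z' < z)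
  exact happrox _ (sub_pos.2 (strictMono_stdNormalCDF hz')) z' (by linarith)

end

/-! ### Expected length and integration along a segment of drifts. -/

/-- The substitution `x = a + θ c`, for either sign of `c`. It is an equality unless `c = 0`, when
the left side is zero even if the integral is infinite. -/
lemma abs_mul_lintegral_comp_affine_le (q : ℝ → ℝ≥0∞) (hq : Measurable q) (a c : ℝ) :
    ENNReal.ofReal |c| * ∫⁻ θ, q (a + θ * c) ≤ ∫⁻ x, q x := by
  rcases eq_or_ne c 0 with rfl | hc
  · simp
  refine le_of_eq ?_
  calc _ = ENNReal.ofReal |c| * ∫⁻ x, q (a + x) ∂(volume.map (· * c)) := by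
        rw [lintegral_map (by fun_prop) (by fun_prop)]
    _ = ∫⁻ x, q (a + x) := by
        rw [← smul_eq_mul, ← lintegral_smul_measure, Real.smul_map_volume_mul_right hc]
    _ = ∫⁻ x, q x := lintegral_add_left_eq_self q a

/-- The expected length of an interval procedure is the integral over `x` of the probability that
the interval contains `x`. -/
lemma lintegral_volume_toSet {Ω : Type*} [MeasurableSpace Ω] {P : Measure Ω}
    [IsProbabilityMeasure P] (C : IntervalProcedure) {Y : Ω → Interval → ℝ}
    (hY : AEMeasurable Y P) :
    ∫⁻ ω, volume (C.toSet (Y ω)) ∂P = ∫⁻ x, P {ω | x ∈ C.toSet (Y ω)} := by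
  have : IsProbabilityMeasure (P.map Y) := Measure.isProbabilityMeasure_map hY
  have hM := C.measurableSet_mem
  calc _ = ∫⁻ y, volume (Prod.mk y ⁻¹' {p : (Interval → ℝ) × ℝ | p.2 ∈ C.toSet p.1})
            ∂(P.map Y) := (lintegral_map' (measurable_measure_prodMk_left hM).aemeasurable hY).symm
    _ = ∫⁻ x, (P.map Y) ((fun y => (y, x)) ⁻¹' {p : (Interval → ℝ) × ℝ | p.2 ∈ C.toSet p.1}) := by
        rw [← Measure.prod_apply hM, Measure.prod_apply_symm hM]
    _ = _ := lintegral_congr fun x =>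
        Measure.map_apply_of_aemeasurable hY (measurable_prodMk_right hM)

section

variable {Ω : Type*} [MeasurableSpace Ω] {P : Measure Ω} [IsProbabilityMeasure P]
  {W : ℝ≥0 → Ω → ℝ} {n α : ℝ} {F : Set (Interval → ℝ)} {f g : Interval → ℝ}

/-- A procedure with guaranteed coverage contains, under the drift `f`, the values at `0` of the
drifts on the segment from `f` to `g` with the probabilities given by the Neyman–Pearson bound. -/
lemma ofReal_stdNormalCDF_le_measure_mem (hW : IsBrownianReal W P) (hn : 0 < n)
    (hF_int : ∀ g ∈ F, Integrable g lebesgue) (hF : Convex ℝ F) (hα0 : 0 < α) (hα : α < 1 / 2)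
    (hf : f ∈ F) (hg : g ∈ F)
    (hfg : eLpNorm (g - f) 2 lebesgue ≤ ENNReal.ofReal (zQuantile α / √n))
    {C : IntervalProcedure} (hC : C.HasCoverage P W n α F) {θ : ℝ} (hθ : θ ∈ Icc (0 : ℝ) 1) :
    ENNReal.ofReal (stdNormalCDF (zQuantile α - θ * zQuantile α))
      ≤ P {ω | f origin + θ * (g origin - f origin) ∈ C.toSet (observation n W f ω)} := by
  have hz := zQuantile_pos hα0 hα
  have hn' := Real.sqrt_pos.2 hn
  set k : Interval → ℝ := f + θ • (g - f) with hk
  have hkF : k ∈ F := hF.add_smul_sub_mem hf hg hθ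
  have hk0 : k origin = f origin + θ * (g origin - f origin) := by simp [hk]
  have hnorm : eLpNorm (f - k) 2 lebesgue ≤ ENNReal.ofReal (θ * (zQuantile α / √n)) := by
    have : f - k = (-θ) • (g - f) := by
      rw [hk]
      module
    rw [this, eLpNorm_const_smul, ENNReal.ofReal_mul hθ.1, enorm_neg, Real.enorm_of_nonneg hθ.1]
    gcongr
  have hA : MeasurableSet {y | k origin ∈ C.toSet y} :=
    (measurable_prodMk_right (y := k origin)) C.measurableSet_mem
  have hcov := hC k hkF
  rw [← stdNormalCDF_zQuantile hα0 hα, ENNReal.ofReal_le_iff_le_toReal (measure_ne_top _ _)] at hcov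
  have := stdNormalCDF_sub_le_observation hW hn (hF_int f hf) (hF_int k hkF)
    (mul_nonneg hθ.1 (div_pos hz hn').le) hnorm hA hcov
  rw [← hk0, ENNReal.ofReal_le_iff_le_toReal (measure_ne_top _ _)]
  convert! this using 2
  field_simp

lemma ofReal_mul_localModulus_le (hW : IsBrownianReal W P) (hn : 0 < n)
    (hF_int : ∀ g ∈ F, Integrable g lebesgue) (hF : Convex ℝ F) (hα0 : 0 < α) (hα : α < 1 / 2)
    (hf : f ∈ F) :
    ENNReal.ofReal (1 - 1 / (√(2 * Real.pi) * zQuantile α)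
          + stdNormalPDF (zQuantile α) / zQuantile α - α)
        * localModulus (zQuantile α / √n) f F
      ≤ minExpectedLength P W n α f F := by
  have hz := zQuantile_pos hα0 hα
  refine le_iInf₂ fun C hC => ?_
  -- Bounding each `g` separately requires neither attainment nor finiteness of the supremum.
  simp only [localModulus, ENNReal.mul_iSup]
  refine iSup_le fun g => iSup_le fun hg => iSup_le fun hfg => ?_
  have hY := aemeasurable_observation hW n f
  rw [IntervalProcedure.expectedLength, lintegral_volume_toSet C hY]
  have hq : Measurable fun x => P {ω | x ∈ C.toSet (observation n W f ω)} := by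
    have : IsProbabilityMeasure (P.map (observation n W f)) := Measure.isProbabilityMeasure_map hY
    have := measurable_measure_prodMk_right (μ := P.map (observation n W f)) C.measurableSet_mem
    convert this using 2 with x
    exact (Measure.map_apply_of_aemeasurable hY (measurable_prodMk_right C.measurableSet_mem)).symm
  refine le_trans ?_ (abs_mul_lintegral_comp_affine_le _ hq (f origin) (g origin - f origin))
  rw [mul_comm]
  gcongr
  have hc : Continuous fun θ => stdNormalCDF (zQuantile α - θ * zQuantile α) :=
    continuous_stdNormalCDF.comp (by fun_prop)
  calc _ = ENNReal.ofReal (∫ θ in Ioc (0 : ℝ) 1,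
            stdNormalCDF (zQuantile α - θ * zQuantile α)) := by
        rw [← intervalIntegral.integral_of_le zero_le_one, integral_stdNormalCDF hz,
          stdNormalCDF_zQuantile hα0 hα]
        congr 1
        ring
    _ = ∫⁻ θ in Ioc (0 : ℝ) 1,
          ENNReal.ofReal (stdNormalCDF (zQuantile α - θ * zQuantile α)) :=
        ofReal_integral_eq_lintegral_ofReal
          (hc.integrableOn_Icc.mono_set Ioc_subset_Icc_self)
          (Eventually.of_forall fun _ => stdNormalCDF_nonneg _)
    _ ≤ ∫⁻ θ in Ioc (0 : ℝ) 1, P {ω | f origin + θ * (g origin - f origin) ∈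
          C.toSet (observation n W f ω)} :=
        setLIntegral_mono' measurableSet_Ioc fun θ hθ =>
          ofReal_stdNormalCDF_le_measure_mem hW hn hF_int hF hα0 hα hf hg hfg hC
            (Ioc_subset_Icc_self hθ)
    _ ≤ _ := setLIntegral_le_lintegral _ _

end

end WhiteNoiseCI

open WhiteNoiseCI in
theorem theorem1 {Ω : Type*} [MeasurableSpace Ω] (P : Measure Ω) [IsProbabilityMeasure P]
    (W : ℝ≥0 → Ω → ℝ) (hW : IsBrownianReal W P) (n : ℝ) (hn : 0 < n)
    (F : Set (Interval → ℝ)) (hF_int : ∀ g ∈ F, Integrable g lebesgue) (hF : Convex ℝ F)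
    (α : ℝ) (hα0 : 0 < α) (hα : α < 1 / 2) (f : Interval → ℝ) (hf : f ∈ F) :
    ENNReal.ofReal (1 - 1 / (√(2 * Real.pi) * zQuantile α)
          + stdNormalPDF (zQuantile α) / zQuantile α - α)
        * localModulus (zQuantile α / √n) f F
      ≤ minExpectedLength P W n α f F ∧
    ENNReal.ofReal (1 - 1 / (√(2 * Real.pi) * zQuantile α))
        * localModulus (zQuantile α / √n) f F
      ≤ minExpectedLength P W n α f F := by
  have h := ofReal_mul_localModulus_le hW hn hF_int hF hα0 hα hf
  -- Comparing the real coefficients suffices: `ENNReal.ofReal` is monotone and sends negative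
  -- values to zero.
  refine ⟨h, le_trans (mul_le_mul' (ENNReal.ofReal_le_ofReal ?_) le_rfl) h⟩
  have hz := zQuantile_pos hα0 hα
  have hmills := mul_one_sub_stdNormalCDF_le hz
  rw [stdNormalCDF_zQuantile hα0 hα, sub_sub_cancel] at hmills
  have : α ≤ stdNormalPDF (zQuantile α) / zQuantile α := by
    rwa [le_div_iff₀ hz, mul_comm]
  linarith
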